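/- Let $(\Omega,\mathcal F,\mathbb P)$ be a probability space. For $\alpha\in(0,1)$ let $B^{\mathcal H}_\alpha=\{B^{\mathcal H}_\alpha(t)\}_{t\ge 0}$ be a Hadamard fractional Brownian motion of parameter $\alpha$ on it, that is, a process with almost surely continuous paths such that, for every $t\ge 0$, almost surely $$B^{\mathcal H}_\alpha(t)=\frac{1}{\sqrt{\Gamma(\alpha)}}\int_0^t\Bigl(\log\frac ts\Bigr)^{(\alpha-1)/2}\,dB(s),$$ where $B$ is a standard Brownian motion (which may depend on $\alpha$) and the integral is the Wiener integral. Then, for every $T>0$ and every $\varepsilon>0$, the random variable $\max_{0\le t\le T}|B^{\mathcal H}_\alpha(t)|$ is integrable for every $\alpha\in(0,1)$, and $$\lim_{\alpha\downarrow 0}\ \alpha^{1/2+\varepsilon}\ \mathbb E\max_{0\le t\le T}\bigl|B^{\mathcal H}_\alpha(t)\bigr|=0 .$$ -/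

import Mathlib

open MeasureTheory ProbabilityTheory Filter Topology
open scoped NNReal ENNReal

noncomputable section

namespace HadamardFBM

/-- Step functions on the half-line, written in the form `∑ c(r) 𝟙_[0,r)` (finite sum over `r`);
since `𝟙_[a,b) = 𝟙_[0,b) - 𝟙_[0,a)` this is the space of all step functions of intervals. -/
def stepFun (c : ℝ≥0 →₀ ℝ) (s : ℝ) : ℝ :=
  c.sum fun r x => x * (Set.Ico (0 : ℝ) (r : ℝ)).indicator (fun _ => (1 : ℝ)) s

/-- The elementary integral of the step function `∑ c(r) 𝟙_[0,r)` with respect to `B`,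
that is, `∑ c(r) (B(r) - B(0))`. -/
def stepIntegral {Ω : Type*} (B : ℝ≥0 → Ω → ℝ) (c : ℝ≥0 →₀ ℝ) (ω : Ω) : ℝ :=
  c.sum fun r x => x * (B r ω - B 0 ω)

/-- `IsWienerIntegral B P f Y` says that the random variable `Y` is (a version of) the Wiener
integral `∫₀^∞ f(s) dB(s)` of the deterministic function `f ∈ L²(0,∞)`: `Y` is the
`L²(P)`-limit of the elementary integrals of step functions that converge to `f` in `L²(0,∞)`.
When `B` is a Brownian motion, `Y` is determined by `f` up to a null event. -/
def IsWienerIntegral {Ω : Type*} [MeasurableSpace Ω] (B : ℝ≥0 → Ω → ℝ) (P : Measure Ω)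
    (f : ℝ → ℝ) (Y : Ω → ℝ) : Prop :=
  MemLp f 2 (volume.restrict (Set.Ioi (0 : ℝ))) ∧ MemLp Y 2 P ∧
    ∃ c : ℕ → (ℝ≥0 →₀ ℝ),
      Tendsto (fun n => eLpNorm (fun s => f s - stepFun (c n) s) 2
        (volume.restrict (Set.Ioi (0 : ℝ)))) atTop (𝓝 0) ∧
      Tendsto (fun n => eLpNorm (fun ω => Y ω - stepIntegral B (c n) ω) 2 P) atTop (𝓝 0)

/-- The kernel `Γ(α)^{-1/2} (log (t/s))_+^{(α-1)/2}`, `s > 0`, which vanishes for `s ≥ t`. -/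
def kernel (α t s : ℝ) : ℝ :=
  if 0 < s ∧ s < t then (Real.sqrt (Real.Gamma α))⁻¹ * (Real.log (t / s)) ^ ((α - 1) / 2) else 0

/-- `X` is a Hadamard fractional Brownian motion of parameter `α` on `(Ω, P)`: for some standard
Brownian motion `B` one has, for every `t ≥ 0`,
`X(t) = Γ(α)^{-1/2} ∫₀ᵗ (log (t/s))^{(α-1)/2} dB(s)` almost surely. The Wiener integrals determine
each `X(t)` up to a null event only; as usual the version with almost surely continuous paths is
taken, so that maxima of paths over compact intervals make sense. -/
structure IsHadamardFBM {Ω : Type*} [MeasurableSpace Ω] (α : ℝ) (X : ℝ≥0 → Ω → ℝ)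
    (P : Measure Ω) : Prop where
  exists_brownian : ∃ B : ℝ≥0 → Ω → ℝ, IsBrownianReal B P ∧
    ∀ t : ℝ≥0, IsWienerIntegral B P (kernel α t) (X t)
  cont : ∀ᵐ ω ∂P, Continuous (fun t => X t ω)

/-- `max_{0 ≤ t ≤ T} |x(t)|`. For a continuous path `x` the supremum is attained. -/
def maxAbs (T : ℝ≥0) (x : ℝ≥0 → ℝ) : ℝ :=
  sSup ((fun t => |x t|) '' Set.Icc 0 T)

end HadamardFBM

end

namespace HadamardFBM

variable {Ω : Type*} [MeasurableSpace Ω] {P : Measure Ω}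

/-! ### Exponential moments of Wiener integrals -/

/-! The limit follows from a bound `E max ≤ C / √α`, with `C` bounded as `α ↓ 0`: the factor `α ^ ε`
is then left over. The bound has two ingredients.

Increments: `X t - X s` is a Wiener integral of the difference of two kernels, so its exponential
moments are at most Gaussian, with variance the squared `L²` norm of that difference. By
`integral_kernel_sub_sq_le` this is at most `K |t - s| ^ α`, where `K` carries `1 / (α Γ(α)) = 1 /
Γ(α + 1)` and so stays bounded.

Chaining: `lintegral_iSup_abs_le_of_increments` bounds the maximum of any continuous process with
such increments. A grid of fixed ratio would have about `1 / α` relevant levels and lead to a bound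
of order `α ^ (-3/2)`. The ratio `M`, of order between `4 ^ (1/α)` and `16 ^ (1/α)`, makes the
standard deviation at least halve from each level to the next, while the logarithm of the number of
points at level `n` is `O((n + 1) / α)`. The levels then sum like `∑ (n + 1) 2⁻ⁿ / √α`. Each level
is handled by the maximal inequality `lintegral_iSup_abs_le`. -/

lemma memLp_stepFun (c : ℝ≥0 →₀ ℝ) :
    MemLp (stepFun c) 2 (volume.restrict (Set.Ioi (0 : ℝ))) := by
  have h : stepFun c = fun s => ∑ r ∈ c.support,
      c r * (Set.Ico (0 : ℝ) (r : ℝ)).indicator (fun _ => (1 : ℝ)) s := rfl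
  rw [h]
  refine memLp_finsetSum _ fun r _ => MemLp.const_mul ?_ _
  refine memLp_indicator_const 2 measurableSet_Ico 1 (Or.inr ?_)
  exact ((Measure.restrict_apply_le _ _).trans_lt (by simp)).ne

lemma integral_stepFun_sq (c : ℝ≥0 →₀ ℝ) :
    ∫ s in Set.Ioi (0 : ℝ), stepFun c s ^ 2 =
      ∑ r ∈ c.support, ∑ q ∈ c.support, c r * (c q * min (r : ℝ) q) := by
  have hind (r q : ℝ≥0) : ∀ s : ℝ, (Set.Ico (0 : ℝ) (r : ℝ)).indicator (fun _ => (1 : ℝ)) s *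
      (Set.Ico (0 : ℝ) (q : ℝ)).indicator (fun _ => (1 : ℝ)) s =
      (Set.Ico (0 : ℝ) (min (r : ℝ) q)).indicator (fun _ => (1 : ℝ)) s := by
    intro s
    simp only [Set.indicator_apply, Set.mem_Ico, lt_min_iff]
    split_ifs <;> first | (exfalso; tauto) | simp
  have hpt (s : ℝ) : stepFun c s ^ 2 = ∑ r ∈ c.support, ∑ q ∈ c.support,
      c r * (c q * (Set.Ico (0 : ℝ) (min (r : ℝ) q)).indicator (fun _ => (1 : ℝ)) s) := by
    rw [sq, stepFun, Finsupp.sum, Finset.sum_mul_sum]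
    refine Finset.sum_congr rfl fun r _ => Finset.sum_congr rfl fun q _ => ?_
    rw [← hind r q s]
    ring
  have hfin (m : ℝ) : IntegrableOn ((Set.Ico (0 : ℝ) m).indicator (fun _ => (1 : ℝ)))
      (Set.Ioi 0) := by
    refine Integrable.integrableOn ?_
    exact (integrable_indicator_iff measurableSet_Ico).2 (by simp)
  simp_rw [hpt]
  rw [integral_finsetSum]
  · refine Finset.sum_congr rfl fun r _ => ?_
    rw [integral_finsetSum]
    · refine Finset.sum_congr rfl fun q _ => ?_
      rw [integral_const_mul, integral_const_mul, ← integral_Ici_eq_integral_Ioi,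
        setIntegral_indicator measurableSet_Ico]
      have : Set.Ici (0 : ℝ) ∩ Set.Ico 0 (min (r : ℝ) q) = Set.Ico 0 (min (r : ℝ) q) :=
        Set.inter_eq_right.2 fun x hx => hx.1
      rw [this]
      simp
    · exact fun q _ => ((hfin _).const_mul _).const_mul _
  · exact fun r _ => integrable_finsetSum _ fun q _ => ((hfin _).const_mul _).const_mul _

lemma stepIntegral_ae_eq {B : ℝ≥0 → Ω → ℝ} (hB : IsPreBrownianReal B P) (c : ℝ≥0 →₀ ℝ) :
    stepIntegral B c =ᵐ[P] fun ω => ∑ r ∈ c.support, c r * B r ω := by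
  filter_upwards [hB.eval_zero_ae_eq_zero] with ω hω
  simp [stepIntegral, Finsupp.sum, hω]

/-- Itô isometry on step functions: the covariance `min r q` of `B` is the `L²` inner product of the
indicators of `[0, r)` and `[0, q)`. -/
lemma map_stepIntegral {B : ℝ≥0 → Ω → ℝ} (hB : IsPreBrownianReal B P) (c : ℝ≥0 →₀ ℝ) :
    P.map (stepIntegral B c) =
      gaussianReal 0 (∫ s in Set.Ioi (0 : ℝ), stepFun c s ^ 2).toNNReal := by
  have := hB.isGaussianProcess.isProbabilityMeasure
  have hL (r : ℝ≥0) : MemLp (fun ω => c r * B r ω) 2 P :=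
    (hB.isGaussianProcess.hasGaussianLaw_eval r).memLp_two.const_mul _
  have hG : HasGaussianLaw (fun ω => ∑ r ∈ c.support, c r * B r ω) P :=
    (hB.isGaussianProcess.smul fun r => c r).hasGaussianLaw_fun_sum
  rw [Measure.map_congr (stepIntegral_ae_eq hB c), hG.map_eq_gaussianReal]
  congr 1
  · rw [integral_finsetSum _ fun r _ => (hL r).integrable (by norm_num)]
    simp [integral_const_mul, hB.integral_eval]
  · congr 1
    rw [integral_stepFun_sq, ← covariance_self hG.aemeasurable,
      covariance_fun_sum_fun_sum' (fun r _ => hL r) (fun r _ => hL r)]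
    simp_rw [covariance_const_mul_left, covariance_const_mul_right, hB.covariance_fun_eval]
    simp

lemma aemeasurable_stepIntegral {B : ℝ≥0 → Ω → ℝ} (hB : IsPreBrownianReal B P)
    (c : ℝ≥0 →₀ ℝ) : AEMeasurable (stepIntegral B c) P :=
  AEMeasurable.congr (Finset.aemeasurable_fun_sum _ fun r _ => (hB.aemeasurable r).const_mul _)
    (stepIntegral_ae_eq hB c).symm

lemma lintegral_exp_stepIntegral {B : ℝ≥0 → Ω → ℝ} (hB : IsPreBrownianReal B P)
    (c : ℝ≥0 →₀ ℝ) (l : ℝ) :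
    ∫⁻ ω, ENNReal.ofReal (Real.exp (l * stepIntegral B c ω)) ∂P =
      ENNReal.ofReal (Real.exp (l ^ 2 * (∫ s in Set.Ioi (0 : ℝ), stepFun c s ^ 2) / 2)) := by
  have hmap := map_stepIntegral hB c
  have hm := aemeasurable_stepIntegral hB c
  have hint : Integrable (fun ω => Real.exp (l * stepIntegral B c ω)) P := by
    have h := integrable_exp_mul_gaussianReal (μ := 0)
      (v := (∫ s in Set.Ioi (0 : ℝ), stepFun c s ^ 2).toNNReal) l
    rw [← hmap] at h
    exact h.comp_aemeasurable hm
  rw [← ofReal_integral_eq_lintegral_ofReal hint (ae_of_all _ fun _ => (Real.exp_pos _).le)]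
  congr 1
  have h := mgf_gaussianReal hmap l
  rw [mgf] at h
  rw [h, Real.coe_toNNReal _ (integral_nonneg fun _ => sq_nonneg _)]
  congr 1
  ring

lemma tendsto_integral_sq_of_tendsto_eLpNorm {S : Type*} [MeasurableSpace S] {μ : Measure S}
    {f : S → ℝ} {g : ℕ → S → ℝ} (hf : MemLp f 2 μ) (hg : ∀ n, MemLp (g n) 2 μ)
    (h : Tendsto (fun n => eLpNorm (fun s => f s - g n s) 2 μ) atTop (𝓝 0)) :
    Tendsto (fun n => ∫ s, g n s ^ 2 ∂μ) atTop (𝓝 (∫ s, f s ^ 2 ∂μ)) := by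
  have key {k : S → ℝ} (hk : MemLp k 2 μ) : ∫ s, k s ^ 2 ∂μ = ‖hk.toLp k‖ ^ 2 := by
    rw [← real_inner_self_eq_norm_sq, L2.inner_def]
    refine integral_congr_ae ?_
    filter_upwards [hk.coeFn_toLp] with s hs
    simp [hs, sq]
  have ht : Tendsto (fun n => (hg n).toLp (g n)) atTop (𝓝 (hf.toLp f)) := by
    rw [Lp.tendsto_Lp_iff_tendsto_eLpNorm'' _ hg f hf]
    refine h.congr fun n => ?_
    rw [← eLpNorm_neg]
    congr 1
    ext s
    simp
  simp_rw [key hf, key (hg _)]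
  exact ht.norm.pow 2

/-- The exponential moments of a Wiener integral are at most those of a centred Gaussian variable
whose variance is the squared `L²` norm of the integrand. -/
lemma IsWienerIntegral.lintegral_exp_le {B : ℝ≥0 → Ω → ℝ} (hB : IsPreBrownianReal B P)
    {f : ℝ → ℝ} {Y : Ω → ℝ} (hY : IsWienerIntegral B P f Y) (l : ℝ) :
    ∫⁻ ω, ENNReal.ofReal (Real.exp (l * Y ω)) ∂P ≤
      ENNReal.ofReal (Real.exp (l ^ 2 * (∫ s in Set.Ioi (0 : ℝ), f s ^ 2) / 2)) := by
  obtain ⟨hf, hYL, c, hc, hI⟩ := hY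
  have hm (n : ℕ) := aemeasurable_stepIntegral hB (c n)
  have hmeas : TendstoInMeasure P (fun n => stepIntegral B (c n)) atTop Y := by
    refine tendstoInMeasure_of_tendsto_eLpNorm (p := 2) (by norm_num)
      (fun n => (hm n).aestronglyMeasurable) hYL.1 (hI.congr fun n => ?_)
    rw [← eLpNorm_neg]
    congr 1
    ext s
    simp
  -- Almost sure convergence along a subsequence suffices for Fatou's lemma, which gives the one
  -- inequality needed; the exact law of `Y` is never used.
  obtain ⟨φ, hφ, hae⟩ := hmeas.exists_seq_tendsto_ae
  have hvar := (tendsto_integral_sq_of_tendsto_eLpNorm hf (fun n => memLp_stepFun (c n)) hc).comp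
    hφ.tendsto_atTop
  have hlim : Tendsto (fun n => ∫⁻ ω, ENNReal.ofReal (Real.exp (l * stepIntegral B (c (φ n)) ω)) ∂P)
      atTop (𝓝 (ENNReal.ofReal
        (Real.exp (l ^ 2 * (∫ s in Set.Ioi (0 : ℝ), f s ^ 2) / 2)))) := by
    simp_rw [lintegral_exp_stepIntegral hB]
    refine ENNReal.tendsto_ofReal ?_
    exact (Real.continuous_exp.tendsto _).comp ((hvar.const_mul _).div_const 2)
  calc ∫⁻ ω, ENNReal.ofReal (Real.exp (l * Y ω)) ∂P
      ≤ ∫⁻ ω, liminf (fun n => ENNReal.ofReal (Real.exp (l * stepIntegral B (c (φ n)) ω)))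
          atTop ∂P := by
        refine lintegral_mono_ae ?_
        filter_upwards [hae] with ω hω
        refine le_of_eq (Tendsto.liminf_eq ?_).symm
        exact ENNReal.tendsto_ofReal ((Real.continuous_exp.tendsto _).comp (hω.const_mul l))
    _ ≤ liminf (fun n => ∫⁻ ω, ENNReal.ofReal (Real.exp (l * stepIntegral B (c (φ n)) ω)) ∂P)
          atTop := lintegral_liminf_le' fun n =>
        (Real.measurable_exp.comp_aemeasurable ((hm _).const_mul l)).ennreal_ofReal
    _ = _ := hlim.liminf_eq

lemma stepFun_sub (c d : ℝ≥0 →₀ ℝ) (s : ℝ) :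
    stepFun (c - d) s = stepFun c s - stepFun d s :=
  Finsupp.sum_sub_index fun _ _ _ => by ring

lemma stepIntegral_sub {Ω' : Type*} (B : ℝ≥0 → Ω' → ℝ) (c d : ℝ≥0 →₀ ℝ) (ω : Ω') :
    stepIntegral B (c - d) ω = stepIntegral B c ω - stepIntegral B d ω :=
  Finsupp.sum_sub_index fun _ _ _ => by ring

lemma tendsto_eLpNorm_sub_sub {S : Type*} [MeasurableSpace S] {μ : Measure S}
    {f g : S → ℝ} {u v : ℕ → S → ℝ} (hf : MemLp f 2 μ) (hg : MemLp g 2 μ)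
    (hu : ∀ n, AEStronglyMeasurable (u n) μ) (hv : ∀ n, AEStronglyMeasurable (v n) μ)
    (h : Tendsto (fun n => eLpNorm (fun s => f s - u n s) 2 μ) atTop (𝓝 0))
    (h' : Tendsto (fun n => eLpNorm (fun s => g s - v n s) 2 μ) atTop (𝓝 0)) :
    Tendsto (fun n => eLpNorm (fun s => (f s - g s) - (u n s - v n s)) 2 μ) atTop (𝓝 0) := by
  refine tendsto_of_tendsto_of_tendsto_of_le_of_le tendsto_const_nhds
    (by simpa using h.add h') (fun _ => zero_le) fun n => ?_
  refine le_trans (le_of_eq ?_) (eLpNorm_sub_le (hf.1.sub (hu n)) (hg.1.sub (hv n)) (by norm_num))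
  congr 1
  ext s
  simp only [Pi.sub_apply]
  ring

lemma IsWienerIntegral.sub {B : ℝ≥0 → Ω → ℝ} (hB : IsPreBrownianReal B P)
    {f g : ℝ → ℝ} {Y Z : Ω → ℝ} (hY : IsWienerIntegral B P f Y) (hZ : IsWienerIntegral B P g Z) :
    IsWienerIntegral B P (fun s => f s - g s) (fun ω => Y ω - Z ω) := by
  obtain ⟨hf, hYL, c, hc, hI⟩ := hY
  obtain ⟨hg, hZL, d, hd, hJ⟩ := hZ
  refine ⟨hf.sub hg, hYL.sub hZL, fun n => c n - d n, ?_, ?_⟩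
  · simp_rw [stepFun_sub]
    exact tendsto_eLpNorm_sub_sub hf hg (fun n => (memLp_stepFun _).1)
      (fun n => (memLp_stepFun _).1) hc hd
  · simp_rw [stepIntegral_sub]
    exact tendsto_eLpNorm_sub_sub hYL hZL
      (fun n => (aemeasurable_stepIntegral hB _).aestronglyMeasurable)
      (fun n => (aemeasurable_stepIntegral hB _).aestronglyMeasurable) hI hJ

end HadamardFBM

namespace HadamardFBM

/-! ### The `L²` norm of increments of the kernel -/

lemma kernel_nonneg (α t s : ℝ) : 0 ≤ kernel α t s := by
  rw [kernel]
  split_ifs with h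
  · exact mul_nonneg (inv_nonneg.2 (Real.sqrt_nonneg _))
      (Real.rpow_nonneg (Real.log_nonneg ((one_le_div h.1).2 h.2.le)) _)
  · exact le_rfl

lemma kernel_of_le {α t s : ℝ} (h : t ≤ s) : kernel α t s = 0 :=
  if_neg fun h' => h'.2.not_ge h

lemma kernel_anti {α s t r : ℝ} (hα : α ≤ 1) (hr : 0 < r) (hrs : r < s) (hst : s ≤ t) :
    kernel α t r ≤ kernel α s r := by
  rw [kernel, kernel, if_pos ⟨hr, hrs.trans_le hst⟩, if_pos ⟨hr, hrs⟩]
  refine mul_le_mul_of_nonneg_left ?_ (inv_nonneg.2 (Real.sqrt_nonneg _))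
  refine Real.rpow_le_rpow_of_nonpos (Real.log_pos ((one_lt_div hr).2 hrs)) ?_ (by linarith)
  exact Real.log_le_log (div_pos (hr.trans hrs) hr) (div_le_div_of_nonneg_right hst hr.le)

/-- Since `log (t / s) ≥ 1 - s / t` and the exponent `α - 1` is nonpositive, the logarithm can be
replaced by `(t - s) / t`. -/
lemma kernel_sq_le {α t s : ℝ} (hα₀ : 0 < α) (hα : α ≤ 1) (hs : 0 < s) (hst : s < t) :
    kernel α t s ^ 2 ≤ (Real.Gamma α)⁻¹ * t ^ (1 - α) * (t - s) ^ (α - 1) := by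
  have ht : 0 < t := hs.trans hst
  have hlog : 0 < Real.log (t / s) := Real.log_pos ((one_lt_div hs).2 hst)
  have hlow : (t - s) / t ≤ Real.log (t / s) := by
    have h := Real.one_sub_inv_le_log_of_pos (div_pos ht hs)
    rwa [inv_div, one_sub_div ht.ne'] at h
  have hΓ := Real.Gamma_pos_of_pos hα₀
  rw [kernel, if_pos ⟨hs, hst⟩, mul_pow, inv_pow, Real.sq_sqrt hΓ.le, mul_assoc,
    ← Real.rpow_natCast, ← Real.rpow_mul hlog.le]
  refine mul_le_mul_of_nonneg_left ?_ (inv_nonneg.2 hΓ.le)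
  have h1 : (α - 1) / 2 * ((2 : ℕ) : ℝ) = α - 1 := by push_cast; ring
  rw [h1]
  calc Real.log (t / s) ^ (α - 1) ≤ ((t - s) / t) ^ (α - 1) :=
        Real.rpow_le_rpow_of_nonpos (div_pos (sub_pos.2 hst) ht) hlow (by linarith)
    _ = t ^ (1 - α) * (t - s) ^ (α - 1) := by
        rw [Real.div_rpow (sub_pos.2 hst).le ht.le, ← neg_sub α 1, Real.rpow_neg ht.le]
        field_simp

/-- The kernel depends on `s / t` only. The value of the constant is irrelevant later; only its sign
matters. -/
lemma integral_kernel_sq_eq {α t : ℝ} (ht : 0 ≤ t) :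
    ∫ s in Set.Ioi (0 : ℝ), kernel α t s ^ 2 =
      t * ∫ s in Set.Ioi (0 : ℝ), kernel α 1 s ^ 2 := by
  rcases ht.eq_or_lt with rfl | ht
  · rw [zero_mul]
    refine setIntegral_eq_zero_of_forall_eq_zero fun s hs => ?_
    rw [kernel_of_le (le_of_lt hs)]
    norm_num
  · have h (s : ℝ) : kernel α t s = kernel α 1 (t⁻¹ * s) := by
      have h1 : 0 < t⁻¹ * s ↔ 0 < s := by
        rw [mul_pos_iff_of_pos_left (inv_pos.2 ht)]
      have h2 : t⁻¹ * s < 1 ↔ s < t := by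
        rw [inv_mul_lt_iff₀ ht, mul_one]
      have h3 : 1 / (t⁻¹ * s) = t / s := by
        rw [one_div, mul_inv, inv_inv, div_eq_mul_inv]
      simp only [kernel, h1, h2, h3]
    simp_rw [h]
    rw [integral_comp_mul_left_Ioi (fun s => kernel α 1 s ^ 2) 0 (inv_pos.2 ht)]
    simp

lemma integral_Ioo_sub_rpow {α s t : ℝ} (hα : 0 < α) (hst : s ≤ t) :
    IntegrableOn (fun r => (t - r) ^ (α - 1)) (Set.Ioo s t) ∧
      ∫ r in Set.Ioo s t, (t - r) ^ (α - 1) = (t - s) ^ α / α := by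
  have h0 : IntervalIntegrable (fun r : ℝ => r ^ (α - 1)) volume (t - t) (t - s) :=
    intervalIntegral.intervalIntegrable_rpow' (by linarith)
  constructor
  · have h := (h0.comp_sub_left t).symm
    simp only [sub_sub_cancel] at h
    exact ((intervalIntegrable_iff_integrableOn_Ioo_of_le hst).1 h)
  · rw [← integral_Ioc_eq_integral_Ioo, ← intervalIntegral.integral_of_le hst,
      intervalIntegral.integral_comp_sub_left (fun r : ℝ => r ^ (α - 1)),
      integral_rpow (Or.inl (by linarith))]
    simp [hα.ne']

/-- The increments of the kernel are `α`-Hölder in squared `L²` norm. -/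
lemma integral_kernel_sub_sq_le {α s t : ℝ} (hα₀ : 0 < α) (hα : α ≤ 1) (hs : 0 ≤ s)
    (hst : s ≤ t) (hks : MemLp (kernel α s) 2 (volume.restrict (Set.Ioi (0 : ℝ))))
    (hkt : MemLp (kernel α t) 2 (volume.restrict (Set.Ioi (0 : ℝ)))) :
    ∫ r in Set.Ioi (0 : ℝ), (kernel α t r - kernel α s r) ^ 2 ≤
      2 * t ^ (1 - α) / Real.Gamma (α + 1) * (t - s) ^ α := by
  obtain ⟨hint, hval⟩ := integral_Ioo_sub_rpow hα₀ hst
  have hΓ := Real.Gamma_pos_of_pos hα₀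
  have ht := hs.trans hst
  set C : ℝ := (Real.Gamma α)⁻¹ * t ^ (1 - α) with hC
  have hC0 : 0 ≤ C := mul_nonneg (inv_nonneg.2 hΓ.le) (Real.rpow_nonneg ht _)
  set G : ℝ → ℝ := (Set.Ioo s t).indicator fun r => C * (t - r) ^ (α - 1) with hG
  have hGint : Integrable G (volume.restrict (Set.Ioi (0 : ℝ))) :=
    ((integrable_indicator_iff measurableSet_Ioo).2 (hint.const_mul C)).integrableOn
  have hGval : ∫ r in Set.Ioi (0 : ℝ), G r = C * ((t - s) ^ α / α) := by
    have hsub : Set.Ioo s t ⊆ Set.Ioi 0 := fun r hr => hs.trans_lt hr.1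
    rw [hG, setIntegral_indicator measurableSet_Ioo, Set.inter_eq_right.2 hsub,
      integral_const_mul, hval]
  -- Below `s` the kernel decreases in `t`, and `0 ≤ a ≤ b` gives `(a - b)² ≤ b² - a²`. On `(s, t)`
  -- only `kernel α t` survives, and `2 * G` compensates for the sign of its square.
  have hptw : ∀ᵐ r ∂volume.restrict (Set.Ioi (0 : ℝ)), (kernel α t r - kernel α s r) ^ 2 ≤
      kernel α s r ^ 2 - kernel α t r ^ 2 + 2 * G r := by
    have hne : ∀ᵐ r ∂volume.restrict (Set.Ioi (0 : ℝ)), r ≠ s :=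
      ae_restrict_of_ae (by simp [ae_iff])
    filter_upwards [ae_restrict_mem measurableSet_Ioi, hne] with r hr hrs
    rcases lt_or_gt_of_ne hrs with h | h
    · have h1 := kernel_anti hα hr h hst
      have h2 := kernel_nonneg α t r
      have h3 : G r = 0 := Set.indicator_of_notMem (fun h' => h'.1.not_gt h) _
      rw [h3]
      nlinarith [mul_nonneg h2 (sub_nonneg.2 h1)]
    · rw [kernel_of_le h.le]
      rcases lt_or_ge r t with h' | h'
      · have h3 : G r = C * (t - r) ^ (α - 1) := Set.indicator_of_mem (Set.mem_Ioo.2 ⟨h, h'⟩) _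
        have h4 := kernel_sq_le hα₀ hα hr h'
        rw [h3]
        linarith
      · have h3 : G r = 0 := Set.indicator_of_notMem (fun h'' => h'.not_gt h''.2) _
        rw [kernel_of_le h', h3]
        norm_num
  have hI := integral_mono_ae (hkt.sub hks).integrable_sq
    ((hks.integrable_sq.sub hkt.integrable_sq).add (hGint.const_mul 2)) hptw
  simp only [Pi.sub_apply, Pi.add_apply] at hI
  refine hI.trans ?_
  have hsplit := integral_add (hks.integrable_sq.sub hkt.integrable_sq) (hGint.const_mul 2)
  simp only [Pi.sub_apply] at hsplit
  rw [hsplit, integral_sub hks.integrable_sq hkt.integrable_sq,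
    integral_const_mul, hGval, integral_kernel_sq_eq hs, integral_kernel_sq_eq ht,
    Real.Gamma_add_one hα₀.ne', hC]
  have hc : 0 ≤ ∫ r in Set.Ioi (0 : ℝ), kernel α 1 r ^ 2 := integral_nonneg fun _ => sq_nonneg _
  have : 2 * ((Real.Gamma α)⁻¹ * t ^ (1 - α) * ((t - s) ^ α / α)) =
      2 * t ^ (1 - α) / (α * Real.Gamma α) * (t - s) ^ α := by
    field_simp
  rw [this]
  -- By scaling, the difference of the two squared norms is `(s - t)` times a nonnegative constant,
  -- so it can be dropped.
  nlinarith [mul_le_mul_of_nonneg_right hst hc]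

end HadamardFBM

namespace HadamardFBM

variable {Ω : Type*} [MeasurableSpace Ω] {P : Measure Ω}

/-! ### Maximal inequality for finitely many sub-Gaussian variables -/

/-- The exponential moments of `Z` are at most those of a centred Gaussian variable of variance
`v`. -/
def ExpMomentLE (P : Measure Ω) (v : ℝ) (Z : Ω → ℝ) : Prop :=
  ∀ l : ℝ, ∫⁻ ω, ENNReal.ofReal (Real.exp (l * Z ω)) ∂P ≤
    ENNReal.ofReal (Real.exp (l ^ 2 * v / 2))

lemma ExpMomentLE.mono {v w : ℝ} {Z : Ω → ℝ} (h : ExpMomentLE P v Z) (hvw : v ≤ w) :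
    ExpMomentLE P w Z := fun l =>
  (h l).trans (ENNReal.ofReal_le_ofReal (Real.exp_le_exp.2 (by gcongr)))

lemma ExpMomentLE.neg {v : ℝ} {Z : Ω → ℝ} (h : ExpMomentLE P v Z) :
    ExpMomentLE P v (fun ω => -Z ω) := fun l => by
  simpa using h (-l)

/-- The tangent bound `x + 1 ≤ exp x` at `x = l |z i| - L` linearises the usual Jensen argument; the
exponential of the maximum is then bounded by a sum over indices and signs. -/
lemma ofReal_abs_le_add_sum_exp {ι : Type*} (s : Finset ι) (z : ι → ℝ) {i : ι} (hi : i ∈ s)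
    {l L : ℝ} (hl : 0 < l) (hL : 0 ≤ L) :
    ENNReal.ofReal |z i| ≤ ENNReal.ofReal (L / l) + ENNReal.ofReal (Real.exp (-L) / l) *
      ∑ j ∈ s, (ENNReal.ofReal (Real.exp (l * z j)) +
        ENNReal.ofReal (Real.exp (l * -z j))) := by
  have hpos (j : ι) : 0 ≤ Real.exp (l * z j) + Real.exp (l * -z j) := by positivity
  simp_rw [← ENNReal.ofReal_add (Real.exp_pos _).le (Real.exp_pos _).le]
  rw [← ENNReal.ofReal_sum_of_nonneg fun j _ => hpos j, ← ENNReal.ofReal_mul (by positivity),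
    ← ENNReal.ofReal_add (by positivity)
      (mul_nonneg (by positivity) (Finset.sum_nonneg fun j _ => hpos j))]
  refine ENNReal.ofReal_le_ofReal ?_
  have h1 : Real.exp (l * |z i|) ≤ ∑ j ∈ s, (Real.exp (l * z j) + Real.exp (l * -z j)) := by
    refine le_trans ?_ (Finset.single_le_sum (fun j _ => hpos j) hi)
    rcases abs_choice (z i) with h | h <;> rw [h] <;>
      linarith [Real.exp_pos (l * z i), Real.exp_pos (l * -z i)]
  have h2 : l * |z i| ≤ L + Real.exp (-L) * Real.exp (l * |z i|) := by
    rw [← Real.exp_add]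
    linarith [Real.add_one_le_exp (-L + l * |z i|)]
  have h3 := mul_le_mul_of_nonneg_left h1 (Real.exp_pos (-L)).le
  rw [div_mul_eq_mul_div, ← add_div, le_div_iff₀ hl]
  linarith

lemma lintegral_iSup_abs_le [IsProbabilityMeasure P] {ι : Type*} (s : Finset ι) {Z : ι → Ω → ℝ}
    (hm : ∀ i ∈ s, AEMeasurable (Z i) P) {v : ℝ} (hv : 0 ≤ v)
    (hZ : ∀ i ∈ s, ExpMomentLE P v (Z i)) {N : ℕ} (hN : 1 ≤ N) (hs : s.card ≤ N)
    {l : ℝ} (hl : 0 < l) :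
    ∫⁻ ω, ⨆ i ∈ s, ENNReal.ofReal |Z i ω| ∂P ≤
      ENNReal.ofReal ((Real.log (2 * N) + l ^ 2 * v / 2 + 1) / l) := by
  -- Chosen so that `exp (-L)` cancels the bound `2 N exp (l² v / 2)` on the expected sum, leaving
  -- the `+ 1` of the conclusion.
  set L : ℝ := Real.log (2 * N) + l ^ 2 * v / 2 with hLdef
  have hN' : (1 : ℝ) ≤ N := by exact_mod_cast hN
  have hL : 0 ≤ L := add_nonneg (Real.log_nonneg (by linarith)) (by positivity)
  have hme (i : ι) (hi : i ∈ s) :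
      AEMeasurable (fun ω => ENNReal.ofReal (Real.exp (l * Z i ω))) P :=
    (Real.measurable_exp.comp_aemeasurable ((hm i hi).const_mul l)).ennreal_ofReal
  have hme' (i : ι) (hi : i ∈ s) :
      AEMeasurable (fun ω => ENNReal.ofReal (Real.exp (l * -Z i ω))) P :=
    (Real.measurable_exp.comp_aemeasurable ((hm i hi).neg.const_mul l)).ennreal_ofReal
  have hms : AEMeasurable (fun ω => ∑ j ∈ s, (ENNReal.ofReal (Real.exp (l * Z j ω)) +
      ENNReal.ofReal (Real.exp (l * -Z j ω)))) P :=
    Finset.aemeasurable_fun_sum _ fun j hj => (hme j hj).add (hme' j hj)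
  set E : ℝ := Real.exp (l ^ 2 * v / 2) with hE
  calc ∫⁻ ω, ⨆ i ∈ s, ENNReal.ofReal |Z i ω| ∂P
      ≤ ∫⁻ ω, (ENNReal.ofReal (L / l) + ENNReal.ofReal (Real.exp (-L) / l) *
          ∑ j ∈ s, (ENNReal.ofReal (Real.exp (l * Z j ω)) +
            ENNReal.ofReal (Real.exp (l * -Z j ω)))) ∂P :=
        lintegral_mono fun ω => iSup₂_le fun i hi =>
          ofReal_abs_le_add_sum_exp s (fun i => Z i ω) hi hl hL
    _ = ENNReal.ofReal (L / l) + ENNReal.ofReal (Real.exp (-L) / l) *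
          ∑ j ∈ s, (∫⁻ ω, ENNReal.ofReal (Real.exp (l * Z j ω)) ∂P +
            ∫⁻ ω, ENNReal.ofReal (Real.exp (l * -Z j ω)) ∂P) := by
        rw [lintegral_add_left measurable_const, lintegral_const, measure_univ, mul_one,
          lintegral_const_mul'' _ hms, lintegral_finsetSum' s (f := fun j ω =>
            ENNReal.ofReal (Real.exp (l * Z j ω)) + ENNReal.ofReal (Real.exp (l * -Z j ω)))
            fun j hj => (hme j hj).add (hme' j hj)]
        congr 2
        exact Finset.sum_congr rfl fun j hj => lintegral_add_left' (hme j hj) _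
    _ ≤ ENNReal.ofReal (L / l) + ENNReal.ofReal (Real.exp (-L) / l) *
          ∑ _j ∈ s, (ENNReal.ofReal E + ENNReal.ofReal E) := by
        gcongr with j hj
        · exact hZ j hj l
        · exact (hZ j hj).neg l
    _ ≤ ENNReal.ofReal (L / l) + ENNReal.ofReal (Real.exp (-L) / l) *
          ENNReal.ofReal (N * (E + E)) := by
        rw [Finset.sum_const, nsmul_eq_mul, ENNReal.ofReal_mul (Nat.cast_nonneg N),
          ENNReal.ofReal_natCast, ENNReal.ofReal_add (Real.exp_pos _).le (Real.exp_pos _).le]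
        gcongr
    _ = ENNReal.ofReal ((L + 1) / l) := by
        rw [← ENNReal.ofReal_mul (by positivity), ← ENNReal.ofReal_add (by positivity)
          (by positivity)]
        congr 1
        have : Real.exp (-L) * (N * (E + E)) = 1 := by
          rw [hLdef, neg_add, Real.exp_add, Real.exp_neg, Real.exp_neg, Real.exp_log (by linarith),
            ← hE]
          have : 0 < E := Real.exp_pos _
          field_simp
          norm_num
        rw [div_mul_eq_mul_div, this, ← add_div]

end HadamardFBM

namespace HadamardFBM

/-! ### Chaining along `M`-adic grids -/

/-- The `k`-th point of the grid of `[0, T]` of mesh `T / M ^ n`. -/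
noncomputable def gridPoint (T : ℝ≥0) (M n k : ℕ) : ℝ≥0 := T * (k / (M : ℝ≥0) ^ n)

/-- The largest increment of the path `x` between a point of the grid of level `n` and its
predecessor of level `n - 1`. -/
noncomputable def chainIncrement (T : ℝ≥0) (M n : ℕ) (x : ℝ≥0 → ℝ) : ℝ≥0∞ :=
  ⨆ k ∈ Finset.range (M ^ n + 1),
    ENNReal.ofReal |x (gridPoint T M n k) - x (gridPoint T M n (k / M * M))|

lemma gridPoint_le {T : ℝ≥0} {M n k : ℕ} (hk : k ≤ M ^ n) : gridPoint T M n k ≤ T := by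
  refine mul_le_of_le_one_right' (div_le_one_of_le₀ ?_ zero_le)
  exact_mod_cast hk

lemma gridPoint_succ_mul {T : ℝ≥0} {M : ℕ} (hM : M ≠ 0) (n k : ℕ) :
    gridPoint T M (n + 1) (k * M) = gridPoint T M n k := by
  have : (M : ℝ≥0) ≠ 0 := Nat.cast_ne_zero.2 hM
  rw [gridPoint, gridPoint, pow_succ, Nat.cast_mul, mul_div_mul_right _ _ this]

lemma abs_gridPoint_sub_le (T : ℝ≥0) {M : ℕ} (hM : M ≠ 0) (n k : ℕ) :
    |(gridPoint T M n k : ℝ) - gridPoint T M n (k / M * M)| ≤ T * (M / (M : ℝ) ^ n) := by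
  have hdiv : ((k : ℝ)) - ((k / M * M : ℕ) : ℝ) = ((k % M : ℕ) : ℝ) := by
    have h : ((k / M * M + k % M : ℕ) : ℝ) = k := by
      exact_mod_cast congrArg (Nat.cast (R := ℝ)) (Nat.div_add_mod' k M)
    rw [← h, Nat.cast_add]
    ring
  have hmod : ((k % M : ℕ) : ℝ) ≤ M := by
    exact_mod_cast (Nat.mod_lt k (Nat.pos_of_ne_zero hM)).le
  have : (gridPoint T M n k : ℝ) - gridPoint T M n (k / M * M) =
      T * (((k % M : ℕ) : ℝ) / (M : ℝ) ^ n) := by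
    rw [← hdiv]
    simp only [gridPoint]
    push_cast
    ring
  rw [this, abs_of_nonneg (by positivity)]
  gcongr

/-- The index of the grid point of level `n` just below `t`. -/
noncomputable def gridIndex (T : ℝ≥0) (M n : ℕ) (t : ℝ≥0) : ℕ := ⌊(t / T : ℝ) * (M : ℝ) ^ n⌋₊

lemma gridIndex_le {T t : ℝ≥0} (ht : t ≤ T) (M n : ℕ) : gridIndex T M n t ≤ M ^ n := by
  refine Nat.floor_le_of_le ?_
  push_cast
  exact mul_le_of_le_one_left (by positivity) (div_le_one_of_le₀ (by exact_mod_cast ht) (by simp))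

/-- Nested floors: the approximation of `t` at one level is the predecessor of the approximation at
the next, so the increments telescope along the chain. -/
lemma gridIndex_succ_div {T : ℝ≥0} {M : ℕ} (hM : M ≠ 0) (n : ℕ) (t : ℝ≥0) :
    gridIndex T M (n + 1) t / M = gridIndex T M n t := by
  rw [gridIndex, gridIndex, ← Nat.floor_div_natCast, pow_succ, ← mul_assoc,
    mul_div_cancel_right₀ _ (Nat.cast_ne_zero.2 hM)]

lemma tendsto_gridPoint_gridIndex {T : ℝ≥0} (hT : 0 < T) {M : ℕ} (hM : 2 ≤ M) (t : ℝ≥0) :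
    Tendsto (fun n => gridPoint T M n (gridIndex T M n t)) atTop (𝓝 t) := by
  rw [← NNReal.tendsto_coe]
  have hpow : Tendsto (fun n : ℕ => (M : ℝ) ^ n) atTop atTop :=
    tendsto_pow_atTop_atTop_of_one_lt (by exact_mod_cast hM)
  have h := ((tendsto_nat_floor_mul_div_atTop (a := (t / T : ℝ)) (by positivity)).comp
    hpow).const_mul (T : ℝ)
  have hT' : (T : ℝ) ≠ 0 := by exact_mod_cast hT.ne'
  rw [mul_div_cancel₀ _ hT'] at h
  refine h.congr fun n => ?_
  simp [gridPoint, gridIndex]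

lemma ofReal_abs_gridPoint_le {T t : ℝ≥0} (ht : t ≤ T) {M : ℕ} (hM : 2 ≤ M) (x : ℝ≥0 → ℝ)
    (n : ℕ) :
    ENNReal.ofReal |x (gridPoint T M n (gridIndex T M n t))| ≤
      ENNReal.ofReal |x 0| + ∑ i ∈ Finset.range (n + 1), chainIncrement T M i x := by
  have hstep (n : ℕ) : ENNReal.ofReal |x (gridPoint T M n (gridIndex T M n t))| ≤
      ENNReal.ofReal |x (gridPoint T M n (gridIndex T M n t / M * M))| +
        chainIncrement T M n x := by
    have h1 : ENNReal.ofReal |x (gridPoint T M n (gridIndex T M n t)) -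
        x (gridPoint T M n (gridIndex T M n t / M * M))| ≤ chainIncrement T M n x :=
      le_iSup₂ (f := fun k (_ : k ∈ Finset.range (M ^ n + 1)) =>
        ENNReal.ofReal |x (gridPoint T M n k) - x (gridPoint T M n (k / M * M))|) _
        (Finset.mem_range_succ_iff.2 (gridIndex_le ht M n))
    refine le_trans ?_ (add_le_add_right h1 _)
    rw [← ENNReal.ofReal_add (abs_nonneg _) (abs_nonneg _)]
    refine ENNReal.ofReal_le_ofReal ?_
    linarith [abs_sub_abs_le_abs_sub (x (gridPoint T M n (gridIndex T M n t)))
      (x (gridPoint T M n (gridIndex T M n t / M * M)))]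
  induction n with
  | zero =>
    -- At level `0` the index is `0` or `1`, and `M ≥ 2` sends both to `0`, so every chain starts at
    -- time `0`.
    have h0 : gridIndex T M 0 t / M = 0 := by
      have := gridIndex_le ht M 0
      rw [pow_zero] at this
      exact Nat.div_eq_of_lt (by omega)
    simpa [h0, gridPoint] using hstep 0
  | succ n ih =>
    refine (hstep (n + 1)).trans ?_
    rw [gridIndex_succ_div (by omega), gridPoint_succ_mul (by omega),
      Finset.sum_range_succ _ (n + 1), ← add_assoc]
    exact add_le_add_left ih _

lemma ofReal_abs_le_add_tsum_chainIncrement {T t : ℝ≥0} (hT : 0 < T) (ht : t ≤ T) {M : ℕ}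
    (hM : 2 ≤ M) {x : ℝ≥0 → ℝ} (hx : Continuous x) :
    ENNReal.ofReal |x t| ≤ ENNReal.ofReal |x 0| + ∑' n, chainIncrement T M n x := by
  have hlim : Tendsto (fun n => ENNReal.ofReal |x (gridPoint T M n (gridIndex T M n t))|) atTop
      (𝓝 (ENNReal.ofReal |x t|)) :=
    ENNReal.tendsto_ofReal
      (((hx.tendsto t).comp (tendsto_gridPoint_gridIndex hT hM t)).abs)
  refine le_of_tendsto' hlim fun n => (ofReal_abs_gridPoint_le ht hM x n).trans ?_
  gcongr
  exact ENNReal.sum_le_tsum _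

variable {Ω : Type*} [MeasurableSpace Ω] {P : Measure Ω}

lemma aemeasurable_chainIncrement {X : ℝ≥0 → Ω → ℝ} (hX : ∀ t, AEMeasurable (X t) P)
    (T : ℝ≥0) (M n : ℕ) : AEMeasurable (fun ω => chainIncrement T M n (X · ω)) P :=
  AEMeasurable.biSup _ (Finset.countable_toSet _) fun _ _ =>
    ((hX _).sub (hX _)).abs.ennreal_ofReal

/-- Take `M = ⌈y⌉` with `y = 4 ^ (1/α) ≥ 4`. Rounding up costs at most a squaring, `M ≤ y + 1 ≤ y²`,
whence the upper bound `16 = 4²`. -/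
lemma exists_grid_ratio {α : ℝ} (hα₀ : 0 < α) (hα : α ≤ 1) :
    ∃ M : ℕ, 2 ≤ M ∧ (4 : ℝ) ≤ (M : ℝ) ^ α ∧ (M : ℝ) ^ α ≤ 16 ∧
      Real.log M ≤ 4 / α := by
  set y : ℝ := (4 : ℝ) ^ (1 / α) with hy
  have hy4 : 4 ≤ y := by
    have h : (1 : ℝ) ≤ 1 / α := (one_le_div hα₀).2 hα
    simpa [hy] using Real.rpow_le_rpow_of_exponent_le (by norm_num : (1 : ℝ) ≤ 4) h
  have hyα : y ^ α = 4 := by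
    rw [hy, ← Real.rpow_mul (by norm_num), one_div_mul_cancel hα₀.ne', Real.rpow_one]
  have hlow : y ≤ ⌈y⌉₊ := Nat.le_ceil y
  have hup : (⌈y⌉₊ : ℝ) ≤ y * y := by
    have := Nat.ceil_lt_add_one (show 0 ≤ y by linarith)
    nlinarith
  have h16 : (⌈y⌉₊ : ℝ) ^ α ≤ 16 := by
    refine (Real.rpow_le_rpow (Nat.cast_nonneg _) hup hα₀.le).trans ?_
    rw [Real.mul_rpow (by linarith) (by linarith), hyα]
    norm_num
  refine ⟨⌈y⌉₊, ?_, ?_, h16, ?_⟩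
  · have : (2 : ℝ) ≤ ⌈y⌉₊ := by linarith
    exact_mod_cast this
  · rw [← hyα]
    exact Real.rpow_le_rpow (by linarith) hlow hα₀.le
  · have hpos : (0 : ℝ) < ⌈y⌉₊ := by linarith
    have h := Real.log_le_log (Real.rpow_pos_of_pos hpos α) h16
    rw [Real.log_rpow hpos] at h
    have h2 : Real.log 16 ≤ 4 := by
      have : (16 : ℝ) = 2 ^ 4 := by norm_num
      rw [this, Real.log_pow]
      have := Real.log_two_lt_d9
      push_cast
      linarith
    rw [le_div_iff₀ hα₀]
    linarith

lemma tsum_add_mul_two_inv_pow (a b : ℝ) :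
    Summable (fun n : ℕ => (a + b * n) * (1 / 2 : ℝ) ^ n) ∧
      ∑' n : ℕ, (a + b * n) * (1 / 2 : ℝ) ^ n = 2 * a + 2 * b := by
  have h1 : HasSum (fun n : ℕ => (1 / 2 : ℝ) ^ n) 2 := hasSum_geometric_two
  have h2 : HasSum (fun n : ℕ => (n : ℝ) * (1 / 2 : ℝ) ^ n) 2 := by
    have h := hasSum_coe_mul_geometric_of_norm_lt_one (r := (1 / 2 : ℝ)) (by norm_num)
    norm_num at h ⊢
    exact h
  have h := (h1.mul_left a).add (h2.mul_left b)
  have he : (fun n : ℕ => a * (1 / 2 : ℝ) ^ n + b * (n * (1 / 2 : ℝ) ^ n)) =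
      fun n : ℕ => (a + b * n) * (1 / 2 : ℝ) ^ n := by
    ext n
    ring
  rw [he] at h
  refine ⟨h.summable, ?_⟩
  rw [h.tsum_eq]
  ring

/-- Expected size of the increments of one level of the chain. -/
lemma lintegral_chainIncrement_le [IsProbabilityMeasure P] {X : ℝ≥0 → Ω → ℝ}
    (hX : ∀ t, AEMeasurable (X t) P) {T : ℝ≥0} {α K : ℝ} (hα₀ : 0 < α) (hα : α ≤ 1) (hK : 0 ≤ K)
    (hinc : ∀ s t : ℝ≥0, s ≤ T → t ≤ T →
      ExpMomentLE P (K * |(t : ℝ) - s| ^ α) (fun ω => X t ω - X s ω))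
    {M : ℕ} (hM : 2 ≤ M) (hM4 : (4 : ℝ) ≤ (M : ℝ) ^ α) (hM16 : (M : ℝ) ^ α ≤ 16)
    (hlogM : Real.log M ≤ 4 / α) (n : ℕ) :
    ∫⁻ ω, chainIncrement T M n (X · ω) ∂P ≤
      ENNReal.ofReal ((3 + 8 * (K * (T : ℝ) ^ α) + 4 * n) * (1 / 2) ^ n / Real.sqrt α) := by
  have hM0 : (0 : ℝ) < M := by exact_mod_cast (by omega : 0 < M)
  set V : ℝ := K * (T : ℝ) ^ α with hV
  have hV0 : 0 ≤ V := mul_nonneg hK (Real.rpow_nonneg T.coe_nonneg _)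
  have hvar (k : ℕ) (hk : k ∈ Finset.range (M ^ n + 1)) : ExpMomentLE P (16 * V * (1 / 4) ^ n)
      (fun ω => X (gridPoint T M n k) ω - X (gridPoint T M n (k / M * M)) ω) := by
    have hk' : k ≤ M ^ n := Finset.mem_range_succ_iff.1 hk
    refine (hinc _ _ (gridPoint_le ((Nat.div_mul_le_self k M).trans hk'))
      (gridPoint_le hk')).mono ?_
    calc K * |(gridPoint T M n k : ℝ) - gridPoint T M n (k / M * M)| ^ α
        ≤ K * (T * (M / (M : ℝ) ^ n)) ^ α := by
          gcongr
          exact abs_gridPoint_sub_le T (by omega) n k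
      _ = V * ((M : ℝ) ^ α / ((M : ℝ) ^ α) ^ n) := by
          rw [Real.mul_rpow T.coe_nonneg (by positivity), Real.div_rpow hM0.le (by positivity),
            ← Real.rpow_natCast, ← Real.rpow_natCast, ← Real.rpow_mul hM0.le,
            ← Real.rpow_mul hM0.le, mul_comm (n : ℝ) α, hV, mul_assoc]
      _ ≤ V * (16 / 4 ^ n) := by gcongr
      _ = 16 * V * (1 / 4) ^ n := by
          rw [one_div, inv_pow]
          ring
  have hsq : 0 < Real.sqrt α := Real.sqrt_pos.2 hα₀
  -- The parameter `l = 2ⁿ / √α` cancels the decay `4⁻ⁿ` of the variance: `l² v / 2` becomes `8 V /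
  -- α`, with the same `1 / α` as in the logarithm of the grid size.
  have hl : 0 < (2 : ℝ) ^ n / Real.sqrt α := by positivity
  have h := lintegral_iSup_abs_le (P := P) (Finset.range (M ^ n + 1))
    (fun k _ => (hX _).sub (hX _)) (by positivity) hvar (N := M ^ n + 1) (by omega)
    (by simp) hl
  refine h.trans (ENNReal.ofReal_le_ofReal ?_)
  have hlog : Real.log (2 * ((M ^ n + 1 : ℕ) : ℝ)) ≤ 2 + n * (4 / α) := by
    have h1 : (1 : ℝ) ≤ (M : ℝ) ^ n := one_le_pow₀ (by exact_mod_cast (by omega : 1 ≤ M))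
    calc Real.log (2 * ((M ^ n + 1 : ℕ) : ℝ)) ≤ Real.log (4 * (M : ℝ) ^ n) := by
          refine Real.log_le_log (by positivity) ?_
          push_cast
          linarith
      _ = Real.log 4 + n * Real.log M := by
          rw [Real.log_mul (by norm_num) (by positivity), Real.log_pow]
      _ ≤ 2 + n * (4 / α) := by
          have h4 : Real.log 4 ≤ 2 := by
            have : (4 : ℝ) = 2 ^ 2 := by norm_num
            rw [this, Real.log_pow]
            have := Real.log_two_lt_d9
            push_cast
            linarith
          gcongr
  have hlv : ((2 : ℝ) ^ n / Real.sqrt α) ^ 2 * (16 * V * (1 / 4) ^ n) / 2 = 8 * V / α := by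
    rw [div_pow, Real.sq_sqrt hα₀.le, ← pow_mul, mul_comm n 2, pow_mul, one_div, inv_pow]
    norm_num
    field_simp
    ring
  rw [hlv, div_le_iff₀ hl]
  have hrhs : (3 + 8 * V + 4 * n) * (1 / 2 : ℝ) ^ n / Real.sqrt α * (2 ^ n / Real.sqrt α) =
      (3 + 8 * V + 4 * n) / α := by
    rw [div_mul_div_comm, Real.mul_self_sqrt hα₀.le, mul_assoc, ← mul_pow]
    norm_num
  rw [hrhs]
  have h3 : 3 ≤ 3 / α := by
    rw [le_div_iff₀ hα₀]
    linarith
  calc Real.log (2 * ((M ^ n + 1 : ℕ) : ℝ)) + 8 * V / α + 1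
      ≤ 2 + n * (4 / α) + 8 * V / α + 1 := by gcongr
    _ ≤ 3 / α + n * (4 / α) + 8 * V / α := by linarith
    _ = (3 + 8 * V + 4 * n) / α := by ring

/-- Dudley-type bound, uniform in `α`, for a process with `α`-Hölder variance of increments. -/
lemma lintegral_iSup_abs_le_of_increments [IsProbabilityMeasure P] {X : ℝ≥0 → Ω → ℝ}
    (hX : ∀ t, AEMeasurable (X t) P) (hcont : ∀ᵐ ω ∂P, Continuous (X · ω))
    {T : ℝ≥0} (hT : 0 < T) {α K : ℝ} (hα₀ : 0 < α) (hα : α ≤ 1) (hK : 0 ≤ K)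
    (h0 : ExpMomentLE P 0 (X 0))
    (hinc : ∀ s t : ℝ≥0, s ≤ T → t ≤ T →
      ExpMomentLE P (K * |(t : ℝ) - s| ^ α) (fun ω => X t ω - X s ω)) :
    ∫⁻ ω, ⨆ t ∈ Set.Icc 0 T, ENNReal.ofReal |X t ω| ∂P ≤
      ENNReal.ofReal ((16 + 16 * (K * (T : ℝ) ^ α)) / Real.sqrt α) := by
  obtain ⟨M, hM, hM4, hM16, hlogM⟩ := exists_grid_ratio hα₀ hα
  set V : ℝ := K * (T : ℝ) ^ α with hV
  have hV0 : 0 ≤ V := mul_nonneg hK (Real.rpow_nonneg T.coe_nonneg _)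
  have hsq : 0 < Real.sqrt α := Real.sqrt_pos.2 hα₀
  -- A crude bound is enough here: `l = 1` and variance `0` give `log 2 + 1 ≤ 2`.
  have hstart : ∫⁻ ω, ENNReal.ofReal |X 0 ω| ∂P ≤ ENNReal.ofReal (2 / Real.sqrt α) := by
    have h := lintegral_iSup_abs_le (P := P) (Finset.range 1) (Z := fun _ => X 0)
      (fun _ _ => hX 0) le_rfl (fun _ _ => h0) (N := 1) le_rfl (by simp) one_pos
    simp only [Finset.range_one, Finset.mem_singleton, iSup_iSup_eq_left] at h
    refine h.trans (ENNReal.ofReal_le_ofReal ?_)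
    have h1 : Real.sqrt α ≤ 1 := Real.sqrt_le_one.2 hα
    have h2 := Real.log_two_lt_d9
    have h3 : 2 ≤ 2 / Real.sqrt α := by
      rw [le_div_iff₀ hsq]
      linarith
    norm_num
    linarith
  obtain ⟨hsum, hval⟩ := tsum_add_mul_two_inv_pow (3 + 8 * V) 4
  calc ∫⁻ ω, ⨆ t ∈ Set.Icc 0 T, ENNReal.ofReal |X t ω| ∂P
      ≤ ∫⁻ ω, (ENNReal.ofReal |X 0 ω| + ∑' n, chainIncrement T M n (X · ω)) ∂P := by
        refine lintegral_mono_ae ?_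
        filter_upwards [hcont] with ω hω
        exact iSup₂_le fun t ht => ofReal_abs_le_add_tsum_chainIncrement hT ht.2 hM hω
    _ = ∫⁻ ω, ENNReal.ofReal |X 0 ω| ∂P + ∑' n, ∫⁻ ω, chainIncrement T M n (X · ω) ∂P := by
        rw [lintegral_add_left' (hX 0).abs.ennreal_ofReal,
          lintegral_tsum fun n => aemeasurable_chainIncrement hX T M n]
    _ ≤ ENNReal.ofReal (2 / Real.sqrt α) + ∑' n : ℕ,
          ENNReal.ofReal ((3 + 8 * V + 4 * n) * (1 / 2) ^ n / Real.sqrt α) := by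
        gcongr with n
        exact lintegral_chainIncrement_le hX hα₀ hα hK hinc hM hM4 hM16 hlogM n
    -- The constants are `2 + 2 (3 + 8 V) + 2 · 4`.
    _ = ENNReal.ofReal ((16 + 16 * V) / Real.sqrt α) := by
        rw [← ENNReal.ofReal_tsum_of_nonneg (fun n => by positivity) (hsum.div_const _),
          tsum_div_const, hval, ← ENNReal.ofReal_add (by positivity) (by positivity)]
        congr 1
        ring

end HadamardFBM

namespace HadamardFBM

variable {Ω : Type*} [MeasurableSpace Ω] {P : Measure Ω}

/-! ### The maximum of a path -/

lemma maxAbs_nonneg (T : ℝ≥0) (x : ℝ≥0 → ℝ) : 0 ≤ maxAbs T x :=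
  Real.sSup_nonneg (by rintro _ ⟨t, _, rfl⟩; exact abs_nonneg _)

/-- No continuity is needed: for an unbounded path the right side is `⊤`. -/
lemma ofReal_maxAbs_le (T : ℝ≥0) (x : ℝ≥0 → ℝ) :
    ENNReal.ofReal (maxAbs T x) ≤ ⨆ t ∈ Set.Icc 0 T, ENNReal.ofReal |x t| := by
  rcases eq_or_ne (⨆ t ∈ Set.Icc 0 T, ENNReal.ofReal |x t|) ⊤ with h | h
  · rw [h]
    exact le_top
  · refine ENNReal.ofReal_le_of_le_toReal (Real.sSup_le ?_ ENNReal.toReal_nonneg)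
    rintro _ ⟨t, ht, rfl⟩
    exact (ENNReal.ofReal_le_iff_le_toReal h).1
      (le_iSup₂ (f := fun t (_ : t ∈ Set.Icc 0 T) => ENNReal.ofReal |x t|) t ht)

lemma abs_le_maxAbs {T t : ℝ≥0} (ht : t ≤ T) {x : ℝ≥0 → ℝ} (hx : Continuous x) :
    |x t| ≤ maxAbs T x :=
  le_csSup (isCompact_Icc.bddAbove_image hx.abs.continuousOn) ⟨t, ⟨zero_le, ht⟩, rfl⟩

/-- Reduces the maximum to countably many times, which yields its measurability. -/
lemma ofReal_maxAbs_eq_iSup_gridPoint {T : ℝ≥0} (hT : 0 < T) {x : ℝ≥0 → ℝ} (hx : Continuous x) :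
    ENNReal.ofReal (maxAbs T x) =
      ⨆ n : ℕ, ⨆ k ∈ Finset.range (2 ^ n + 1), ENNReal.ofReal |x (gridPoint T 2 n k)| := by
  refine le_antisymm ((ofReal_maxAbs_le T x).trans ?_) ?_
  · refine iSup₂_le fun t ht => ?_
    refine le_of_tendsto' (ENNReal.tendsto_ofReal
      (((hx.tendsto t).comp (tendsto_gridPoint_gridIndex hT le_rfl t)).abs)) fun n => ?_
    refine le_iSup_of_le n (le_iSup₂ (f := fun k (_ : k ∈ Finset.range (2 ^ n + 1)) =>
      ENNReal.ofReal |x (gridPoint T 2 n k)|) _ ?_)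
    exact Finset.mem_range_succ_iff.2 (gridIndex_le ht.2 2 n)
  · refine iSup_le fun n => iSup₂_le fun k hk => ENNReal.ofReal_le_ofReal ?_
    exact abs_le_maxAbs (gridPoint_le (Finset.mem_range_succ_iff.1 hk)) hx

lemma aemeasurable_maxAbs {X : ℝ≥0 → Ω → ℝ} (hX : ∀ t, AEMeasurable (X t) P)
    (hcont : ∀ᵐ ω ∂P, Continuous (X · ω)) {T : ℝ≥0} (hT : 0 < T) :
    AEMeasurable (fun ω => maxAbs T (X · ω)) P := by
  have h : AEMeasurable (fun ω => ⨆ n : ℕ, ⨆ k ∈ Finset.range (2 ^ n + 1),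
      ENNReal.ofReal |X (gridPoint T 2 n k) ω|) P :=
    AEMeasurable.iSup fun n => AEMeasurable.biSup _ (Finset.countable_toSet _) fun k _ =>
      (hX _).abs.ennreal_ofReal
  refine h.ennreal_toReal.congr ?_
  filter_upwards [hcont] with ω hω
  rw [← ofReal_maxAbs_eq_iSup_gridPoint hT hω, ENNReal.toReal_ofReal (maxAbs_nonneg _ _)]

/-! ### Hadamard fractional Brownian motion -/

lemma IsHadamardFBM.aemeasurable {α : ℝ} {X : ℝ≥0 → Ω → ℝ} (hX : IsHadamardFBM α X P) (t : ℝ≥0) :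
    AEMeasurable (X t) P := by
  obtain ⟨B, -, h⟩ := hX.exists_brownian
  exact (h t).2.1.1.aemeasurable

lemma IsHadamardFBM.expMomentLE_zero {α : ℝ} {X : ℝ≥0 → Ω → ℝ} (hX : IsHadamardFBM α X P) :
    ExpMomentLE P 0 (X 0) := by
  obtain ⟨B, hB, h⟩ := hX.exists_brownian
  intro l
  have h1 := (h 0).lintegral_exp_le hB.toIsPreBrownianReal l
  have h2 := integral_kernel_sq_eq (α := α) (le_refl (0 : ℝ))
  rw [zero_mul] at h2
  rwa [NNReal.coe_zero, h2] at h1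

lemma IsHadamardFBM.expMomentLE_sub {α : ℝ} (hα₀ : 0 < α) (hα : α ≤ 1) {X : ℝ≥0 → Ω → ℝ}
    (hX : IsHadamardFBM α X P) {s t T : ℝ≥0} (hs : s ≤ T) (ht : t ≤ T) :
    ExpMomentLE P (2 * max (T : ℝ) 1 / Real.Gamma (α + 1) * |(t : ℝ) - s| ^ α)
      (fun ω => X t ω - X s ω) := by
  wlog hst : s ≤ t generalizing s t
  · have h := (this ht hs (le_of_not_ge hst)).neg
    simpa only [neg_sub, abs_sub_comm (s : ℝ) t] using h
  obtain ⟨B, hB, h⟩ := hX.exists_brownian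
  have hst' : (s : ℝ) ≤ t := by exact_mod_cast hst
  have hk := integral_kernel_sub_sq_le hα₀ hα s.coe_nonneg hst' (h s).1 (h t).1
  have hΓ : 0 < Real.Gamma (α + 1) := Real.Gamma_pos_of_pos (by linarith)
  -- The maximum with `1` makes the bound uniform in `α`, also when `T < 1`.
  have hpow : (t : ℝ) ^ (1 - α) ≤ max (T : ℝ) 1 := by
    have h1 : (t : ℝ) ≤ max (T : ℝ) 1 := le_max_of_le_left (by exact_mod_cast ht)
    refine (Real.rpow_le_rpow t.coe_nonneg h1 (by linarith)).trans ?_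
    simpa using Real.rpow_le_rpow_of_exponent_le (le_max_right (T : ℝ) 1)
      (by linarith : 1 - α ≤ 1)
  have hvar : ExpMomentLE P (∫ r in Set.Ioi (0 : ℝ), (kernel α t r - kernel α s r) ^ 2)
      (fun ω => X t ω - X s ω) :=
    ((h t).sub hB.toIsPreBrownianReal (h s)).lintegral_exp_le hB.toIsPreBrownianReal
  refine hvar.mono (hk.trans ?_)
  rw [abs_of_nonneg (sub_nonneg.2 hst')]
  have := Real.rpow_nonneg (sub_nonneg.2 hst') α
  gcongr

lemma IsHadamardFBM.lintegral_maxAbs_le [IsProbabilityMeasure P] {α : ℝ} (hα₀ : 0 < α)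
    (hα : α ≤ 1) {X : ℝ≥0 → Ω → ℝ} (hX : IsHadamardFBM α X P) {T : ℝ≥0} (hT : 0 < T) :
    ∫⁻ ω, ENNReal.ofReal (maxAbs T (X · ω)) ∂P ≤
      ENNReal.ofReal ((16 + 32 * max (T : ℝ) 1 ^ 2 / Real.Gamma (α + 1)) / Real.sqrt α) := by
  have hΓ : 0 < Real.Gamma (α + 1) := Real.Gamma_pos_of_pos (by linarith)
  have hmax : 1 ≤ max (T : ℝ) 1 := le_max_right _ _
  have h := lintegral_iSup_abs_le_of_increments hX.aemeasurable hX.cont hT hα₀ hα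
    (by positivity) hX.expMomentLE_zero fun s t hs ht => hX.expMomentLE_sub hα₀ hα hs ht
  refine (lintegral_mono fun ω => ofReal_maxAbs_le T _).trans
    (h.trans (ENNReal.ofReal_le_ofReal ?_))
  have hpow : (T : ℝ) ^ α ≤ max (T : ℝ) 1 := by
    refine (Real.rpow_le_rpow T.coe_nonneg (le_max_left _ 1) hα₀.le).trans ?_
    simpa using Real.rpow_le_rpow_of_exponent_le hmax hα
  have : 16 * (2 * max (T : ℝ) 1 / Real.Gamma (α + 1) * (T : ℝ) ^ α) ≤
      32 * max (T : ℝ) 1 ^ 2 / Real.Gamma (α + 1) := by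
    calc 16 * (2 * max (T : ℝ) 1 / Real.Gamma (α + 1) * (T : ℝ) ^ α)
        ≤ 16 * (2 * max (T : ℝ) 1 / Real.Gamma (α + 1) * max (T : ℝ) 1) := by gcongr
      _ = _ := by ring
  gcongr

lemma IsHadamardFBM.integrable_maxAbs [IsProbabilityMeasure P] {α : ℝ} (hα₀ : 0 < α)
    (hα : α ≤ 1) {X : ℝ≥0 → Ω → ℝ} (hX : IsHadamardFBM α X P) {T : ℝ≥0} (hT : 0 < T) :
    Integrable (fun ω => maxAbs T (X · ω)) P := by
  refine ⟨(aemeasurable_maxAbs hX.aemeasurable hX.cont hT).aestronglyMeasurable, ?_⟩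
  rw [hasFiniteIntegral_iff_ofReal (ae_of_all _ fun _ => maxAbs_nonneg _ _)]
  exact (hX.lintegral_maxAbs_le hα₀ hα hT).trans_lt ENNReal.ofReal_lt_top

lemma IsHadamardFBM.integral_maxAbs_le [IsProbabilityMeasure P] {α : ℝ} (hα₀ : 0 < α)
    (hα : α ≤ 1) {X : ℝ≥0 → Ω → ℝ} (hX : IsHadamardFBM α X P) {T : ℝ≥0} (hT : 0 < T) :
    ∫ ω, maxAbs T (X · ω) ∂P ≤
      (16 + 32 * max (T : ℝ) 1 ^ 2 / Real.Gamma (α + 1)) / Real.sqrt α := by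
  have hΓ : 0 < Real.Gamma (α + 1) := Real.Gamma_pos_of_pos (by linarith)
  rw [integral_eq_lintegral_of_nonneg_ae (ae_of_all _ fun _ => maxAbs_nonneg _ _)
    (hX.integrable_maxAbs hα₀ hα hT).1]
  exact ENNReal.toReal_le_of_le_ofReal (by positivity) (hX.lintegral_maxAbs_le hα₀ hα hT)

end HadamardFBM

theorem theorem4p4 {Ω : Type*} [MeasurableSpace Ω] (P : Measure Ω) [IsProbabilityMeasure P]
    (X : ℝ → ℝ≥0 → Ω → ℝ)
    (hX : ∀ α ∈ Set.Ioo (0 : ℝ) 1, HadamardFBM.IsHadamardFBM α (X α) P)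
    (T : ℝ≥0) (hT : 0 < T) (ε : ℝ) (hε : 0 < ε) :
    (∀ α ∈ Set.Ioo (0 : ℝ) 1,
      Integrable (fun ω => HadamardFBM.maxAbs T (fun t => X α t ω)) P) ∧
    Tendsto
      (fun α : ℝ => α ^ (1 / 2 + ε) * ∫ ω, HadamardFBM.maxAbs T (fun t => X α t ω) ∂P)
      (𝓝[>] 0) (𝓝 0) := by
  refine ⟨fun α hα => (hX α hα).integrable_maxAbs hα.1 hα.2.le hT, ?_⟩
  -- The bracket converges because `Γ(α + 1) → Γ(1) = 1`, so `α ^ ε` decides the limit.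
  have hlim : Tendsto (fun α : ℝ => α ^ ε *
      (16 + 32 * max (T : ℝ) 1 ^ 2 / Real.Gamma (α + 1))) (𝓝[>] 0) (𝓝 0) := by
    have h1 : Tendsto (fun α : ℝ => α ^ ε) (𝓝[>] 0) (𝓝 0) := by
      have h := (Real.continuousAt_rpow_const 0 ε (Or.inr hε.le)).tendsto
      rw [Real.zero_rpow hε.ne'] at h
      exact h.mono_left nhdsWithin_le_nhds
    have h2 : Tendsto (fun α : ℝ => Real.Gamma (α + 1)) (𝓝[>] 0) (𝓝 1) := by
      have hc : ContinuousAt (fun α : ℝ => Real.Gamma (α + 1)) 0 := by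
        refine ContinuousAt.comp (g := Real.Gamma) ?_ (by fun_prop)
        refine (Real.differentiableAt_Gamma fun m => ?_).continuousAt
        have : (0 : ℝ) ≤ m := Nat.cast_nonneg m
        linarith
      have h := hc.tendsto
      rw [zero_add, Real.Gamma_one] at h
      exact h.mono_left nhdsWithin_le_nhds
    have h := h1.mul (tendsto_const_nhds (x := (16 : ℝ)) |>.add
      ((tendsto_const_nhds (x := 32 * max (T : ℝ) 1 ^ 2)).div h2 one_ne_zero))
    rwa [zero_mul] at h
  have hmem : Set.Ioo (0 : ℝ) 1 ∈ 𝓝[>] (0 : ℝ) := Ioo_mem_nhdsGT one_pos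
  refine tendsto_of_tendsto_of_tendsto_of_le_of_le' tendsto_const_nhds hlim ?_ ?_
  · filter_upwards [hmem] with α hα
    exact mul_nonneg (Real.rpow_nonneg hα.1.le _)
      (integral_nonneg fun _ => HadamardFBM.maxAbs_nonneg _ _)
  · filter_upwards [hmem] with α hα
    have hsq : 0 < Real.sqrt α := Real.sqrt_pos.2 hα.1
    calc α ^ (1 / 2 + ε) * ∫ ω, HadamardFBM.maxAbs T (fun t => X α t ω) ∂P
        ≤ α ^ (1 / 2 + ε) *
            ((16 + 32 * max (T : ℝ) 1 ^ 2 / Real.Gamma (α + 1)) / Real.sqrt α) :=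
          mul_le_mul_of_nonneg_left ((hX α hα).integral_maxAbs_le hα.1 hα.2.le hT)
            (Real.rpow_nonneg hα.1.le _)
      _ = α ^ ε * (16 + 32 * max (T : ℝ) 1 ^ 2 / Real.Gamma (α + 1)) := by
          rw [Real.rpow_add hα.1, ← Real.sqrt_eq_rpow]
          field_simp
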